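/- Setting. Let $\sigma:\mathbb R\to\mathbb R$ be locally absolutely continuous with $\mathbb E[\sigma'(X)^2]<\infty$ and normalized by $\mathbb E[\sigma(X)]=0$, $\mathbb E[\sigma(X)^2]=1$, where $X\sim\mathcal N(0,1)$. Let $\mu:=1-(\mathbb E[X\sigma(X)])^2$ be its coefficient of nonlinearity, and assume $\mu>0$ (that is, $\sigma(x)\neq\pm x$ as a function). For $\tau\in\{\sigma,\sigma'\}$ and $\rho\in[-1,1]$ let the dual activation $\hat\tau(\rho)$ be the common value of $\mathbb E_{\mathbf w\sim\mathcal N(0,I)}[\tau(\mathbf w\cdot\mathbf u)\,\tau(\mathbf w\cdot\mathbf v)]$ over unit vectors $\mathbf u,\mathbf v$ with $\mathbf u\cdot\mathbf v=\rho$; write $\hat\sigma^{(h)}$ for the $h$-fold composition of $\hat\sigma$ (with $\hat\sigma^{(0)}(\rho)=\rho$) and $\hat{\dot\sigma}$ for the dual of $\sigma'$. Let $\mathbf x_1,\dots,\mathbf x_n\in\mathbb R^d$, $n\ge 2$, be unit vectors, $\rho_{ij}=\mathbf x_i\cdot\mathbf x_j$, and $\delta_{ij}=1-|\rho_{ij}|$.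 The neural tangent kernel (NTK) matrix of depth $L\in\mathbb N$ is $$K_{ij}=\sum_{h=1}^{L+1}\hat\sigma^{(h-1)}(\rho_{ij})\prod_{h'=h}^{L}\hat{\dot\sigma}\bigl(\hat\sigma^{(h')}(\rho_{ij})\bigr).$$ Statement. Let $0<\delta\le\min_{i\ne j}\delta_{ij}$ (for instance $\delta=\min_{i\neq j}\delta_{ij}$, if this is positive), and let $L\ge L_{\mathrm{conv}}:=\dfrac{8\log(n/\delta)}{\mu}$. Then $K_{11}>0$ and, for all $i\ne j$, $$\left|\frac{K_{ij}}{K_{11}}\right|\le\left(\frac{\delta}{\delta_{ij}\,n}\right)^2\ \text{ if }\delta_{ij}<\tfrac12,\qquad \left|\frac{K_{ij}}{K_{11}}\right|\le\left(\frac{\delta}{n}\right)^2\ \text{ if }\delta_{ij}\ge\tfrac12,$$ and in particular $\left|K_{ij}/K_{11}\right|\le 1/n^2$. -/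

import Mathlib

open MeasureTheory ProbabilityTheory
open scoped RealInnerProductSpace

namespace DeepNTK

noncomputable section

/-- The separability `δ(u, v) = 1 - |u · v|` of two data points. -/
def separability {d : ℕ} (u v : EuclideanSpace ℝ (Fin d)) : ℝ := 1 - |⟪u, v⟫|

/-- The separability of a dataset: the minimum of `δ(x i, x j)` over all pairs `i ≠ j`
(an infimum over a finite set, nonempty as soon as `2 ≤ n`). -/
def datasetSeparability {n d : ℕ} (x : Fin n → EuclideanSpace ℝ (Fin d)) : ℝ :=
  ⨅ p : {p : Fin n × Fin n // p.1 ≠ p.2}, separability (x p.1.1) (x p.1.2)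

/-- The activation function `σ` is admissible: it has a derivative in the (weak) sense needed by
the NTK, i.e. it is locally absolutely continuous with `σ'(X)` square integrable,
and it is normalized, `E[σ(X)] = 0` and `E[σ(X)²] = 1`, where `X ∼ N(0, 1)`. -/
structure IsNormalizedActivation (σ : ℝ → ℝ) : Prop where
  absCont : ∀ a b : ℝ, AbsolutelyContinuousOnInterval σ a b
  deriv_memLp : MemLp (deriv σ) 2 (gaussianReal 0 1)
  memLp : MemLp σ 2 (gaussianReal 0 1)
  mean_eq_zero : ∫ z, σ z ∂gaussianReal 0 1 = 0
  second_moment_eq_one : ∫ z, σ z ^ 2 ∂gaussianReal 0 1 = 1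

/-- The coefficient of nonlinearity `μ = 1 - (E[X σ(X)])²`, `X ∼ N(0, 1)`. -/
def nonlinearity (σ : ℝ → ℝ) : ℝ := 1 - (∫ z, z * σ z ∂gaussianReal 0 1) ^ 2

/-- `E[σ(w · u) σ(w · v)]` for `w ∼ N(0, I_d)`. -/
def dualPair {d : ℕ} (σ : ℝ → ℝ) (u v : EuclideanSpace ℝ (Fin d)) : ℝ :=
  ∫ w, σ ⟪w, u⟫ * σ ⟪w, v⟫ ∂stdGaussian (EuclideanSpace ℝ (Fin d))

/-- The dual activation function `σ̂(ρ)`, for `ρ ∈ [-1, 1]`: the common value of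
`E[σ(w · u) σ(w · v)]`, `w ∼ N(0, I_d)`, over all unit vectors `u, v` with `u · v = ρ`
(see `dualPair_eq_dualActivation`), computed at `u = (1, 0)`, `v = (ρ, √(1 - ρ²))`. -/
def dualActivation (σ : ℝ → ℝ) (ρ : ℝ) : ℝ :=
  ∫ z : ℝ × ℝ, σ z.1 * σ (ρ * z.1 + √(1 - ρ ^ 2) * z.2)
    ∂((gaussianReal 0 1).prod (gaussianReal 0 1))

/-- `E[σ(w · u) σ(w · v)]` depends only on `u · v`. -/
theorem dualPair_eq_dualActivation {d : ℕ} {σ : ℝ → ℝ} (hσ : Measurable σ)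
    (u v : EuclideanSpace ℝ (Fin d)) (hu : ‖u‖ = 1) (hv : ‖v‖ = 1) :
    dualPair σ u v = dualActivation σ ⟪u, v⟫ := by
  set ρ : ℝ := ⟪u, v⟫ with hρ
  have hρ1 : ρ ^ 2 ≤ 1 := by
    have h := abs_real_inner_le_norm u v
    rw [hu, hv, one_mul, ← hρ] at h
    exact (sq_le_one_iff_abs_le_one ρ).2 h
  have hs : √(1 - ρ ^ 2) ^ 2 = 1 - ρ ^ 2 := Real.sq_sqrt (by linarith)
  let A : EuclideanSpace ℝ (Fin d) →L[ℝ] ℝ × ℝ := (innerSL ℝ u).prod (innerSL ℝ v)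
  let C : ℝ × ℝ →L[ℝ] ℝ × ℝ :=
    (ContinuousLinearMap.fst ℝ ℝ ℝ).prod
      (ρ • ContinuousLinearMap.fst ℝ ℝ ℝ + √(1 - ρ ^ 2) • ContinuousLinearMap.snd ℝ ℝ ℝ)
  have key : (stdGaussian (EuclideanSpace ℝ (Fin d))).map A =
      ((gaussianReal 0 1).prod (gaussianReal 0 1)).map C := by
    apply Measure.ext_of_charFunDual
    ext T
    rw [charFunDual_map, charFunDual_map, charFunDual_prod, charFunDual_stdGaussian]
    have h1 : ∀ S : StrongDual ℝ ℝ, charFunDual (gaussianReal 0 1) S =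
        Complex.exp (-((S 1 ^ 2 : ℝ) : ℂ) / 2) := by
      intro S
      have hS : S = InnerProductSpace.toDualMap ℝ ℝ (S 1) := by
        ext; simp
      rw [hS, ← charFun_eq_charFunDual_toDualMap, charFun_gaussianReal, ← hS]
      simp [neg_div]
    have hTA : T ∘SL A = innerSL ℝ (T (1, 0) • u + T (0, 1) • v) := by
      ext w
      have : ((⟪u, w⟫, ⟪v, w⟫) : ℝ × ℝ) = ⟪u, w⟫ • (1, 0) + ⟪v, w⟫ • (0, 1) := by simp
      simp only [A, ContinuousLinearMap.comp_apply, ContinuousLinearMap.prod_apply,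
        innerSL_apply_apply, this, map_add, map_smul, smul_eq_mul, add_apply,
        smul_apply]
      ring
    have hC : ∀ a b : ℝ, T (a, b) = a * T (1, 0) + b * T (0, 1) := by
      intro a b
      have : ((a, b) : ℝ × ℝ) = a • (1, 0) + b • (0, 1) := by simp
      rw [this, map_add, map_smul, map_smul, smul_eq_mul, smul_eq_mul]
    have hn : ‖T (1, 0) • u + T (0, 1) • v‖ ^ 2 =
        (T (1, 0) + ρ * T (0, 1)) ^ 2 + (√(1 - ρ ^ 2) * T (0, 1)) ^ 2 := by
      rw [norm_add_sq_real, norm_smul, norm_smul, hu, hv, real_inner_smul_left,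
        real_inner_smul_right, ← hρ, mul_pow √(1 - ρ ^ 2), hs, mul_one, mul_one,
        Real.norm_eq_abs, Real.norm_eq_abs, sq_abs, sq_abs]
      ring
    rw [h1, h1, hTA, innerSL_apply_norm, ← Complex.exp_add, ← Complex.ofReal_pow, hn]
    simp only [C, ContinuousLinearMap.comp_apply, ContinuousLinearMap.inl_apply,
      ContinuousLinearMap.inr_apply, ContinuousLinearMap.prod_apply,
      add_apply, smul_apply,
      ContinuousLinearMap.coe_fst', ContinuousLinearMap.coe_snd', smul_eq_mul,
      mul_zero, mul_one, add_zero, zero_add, hC 1 ρ, hC 0 √(1 - ρ ^ 2), one_mul, zero_mul]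
    congr 1
    push_cast
    ring
  have hF : Measurable (fun p : ℝ × ℝ ↦ σ p.1 * σ p.2) := by fun_prop
  calc dualPair σ u v
      = ∫ p, σ p.1 * σ p.2 ∂((stdGaussian (EuclideanSpace ℝ (Fin d))).map A) := by
        rw [integral_map (by fun_prop) hF.aestronglyMeasurable]
        simp [dualPair, A, real_inner_comm]
    _ = dualActivation σ ρ := by
        rw [key, integral_map (by fun_prop) hF.aestronglyMeasurable]
        simp [dualActivation, C]

/-- The NTK of depth `L` as a function of the inner product `ρ`:
`∑_{h = 1}^{L + 1} σ̂^{(h - 1)}(ρ) ∏_{h' = h}^{L} (dual of σ')(σ̂^{(h')}(ρ))`,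
where `σ̂^{(h)}` is the `h`-fold composition of `σ̂`. -/
def ntkFun (σ : ℝ → ℝ) (L : ℕ) (ρ : ℝ) : ℝ :=
  ∑ h ∈ Finset.Icc 1 (L + 1), (dualActivation σ)^[h - 1] ρ *
    ∏ h' ∈ Finset.Icc h L, dualActivation (deriv σ) ((dualActivation σ)^[h'] ρ)

/-- The NTK matrix `K` of a dataset. -/
def ntkMatrix {n d : ℕ} (σ : ℝ → ℝ) (L : ℕ) (x : Fin n → EuclideanSpace ℝ (Fin d)) :
    Matrix (Fin n) (Fin n) ℝ :=
  Matrix.of fun i j ↦ ntkFun σ L ⟪x i, x j⟫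

/-- The convergence depth `L_conv = 8 log(n / δ) / μ`. -/
def convDepth (n : ℕ) (δ μ : ℝ) : ℝ := 8 * Real.log (n / δ) / μ

end

end DeepNTK

namespace DeepNTK

open Filter Topology Set

/-! Write `S = E[σ'(X)²]`. In Hermite terms, `σ̂(ρ) = ∑ p_m ρ^m` with `p_m ≥ 0`, `p_0 = 0`, `p_1 = 1
- μ` and `∑ p_m = 1`, so `|σ̂(ρ)| ≤ |ρ| (1 - μ (1 - |ρ|))`. The dual of `σ'` is `(E σ')² = 1 - μ` at
`0` and `S` at `1`; as `S ≥ 1` by the Gaussian Poincaré inequality, it is at most `S (1 - μ (1 -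
|ρ|))` in absolute value. Values and derivatives thus shrink by the same factor. With `τ_{k+1} = τ_k
(1 - μ (1 - τ_k))`, `τ_0 = |ρ|`, the products telescope and every summand of `K_ij` is at most `τ_L`
times that of `K_11` (`abs_ntkFun_le`). The odds `τ / (1 - τ)` decay like `(1 + μ)^(-L)`, so `τ_L ≤
(δ / n)^4 / δ_ij` at the convergence depth. Hermite polynomials never appear: the exponentials `exp
(a x)` span a dense subspace of `L²` on which the dual form is explicit (`hasSum_dualForm`), and
continuity extends the bounds (`abs_dualForm_le`). -/

theorem inner_toLp {α : Type*} [MeasurableSpace α] {ν : Measure α} {f g : α → ℝ}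
    (hf : MemLp f 2 ν) (hg : MemLp g 2 ν) :
    ⟪hf.toLp f, hg.toLp g⟫ = ∫ x, f x * g x ∂ν := by
  rw [L2.inner_def]
  apply integral_congr_ae
  filter_upwards [hf.coeFn_toLp, hg.coeFn_toLp] with x h1 h2
  rw [h1, h2]
  simp [mul_comm]

/-! ### Exponential moments and Gaussian integration by parts. -/

theorem integrable_pow_mul_exp (k : ℕ) (a : ℝ) :
    Integrable (fun x : ℝ ↦ x ^ k * Real.exp (a * x)) (gaussianReal 0 1) :=
  integrable_pow_mul_exp_of_mem_interior_integrableExpSet (X := fun x : ℝ ↦ x) (by simp) k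

theorem memLp_pow_mul_exp (k : ℕ) (a : ℝ) :
    MemLp (fun x : ℝ ↦ x ^ k * Real.exp (a * x)) 2 (gaussianReal 0 1) := by
  rw [memLp_two_iff_integrable_sq (by fun_prop)]
  refine (integrable_pow_mul_exp (k * 2) (2 * a)).congr (ae_of_all _ fun x ↦ ?_)
  simp only [mul_pow, ← Real.exp_nat_mul, pow_mul]
  push_cast
  ring_nf

theorem memLp_exp (a : ℝ) :
    MemLp (fun x : ℝ ↦ Real.exp (a * x)) 2 (gaussianReal 0 1) := by
  simpa using memLp_pow_mul_exp 0 a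

theorem memLp_sub_mul_exp (a : ℝ) :
    MemLp (fun x : ℝ ↦ (x - a) * Real.exp (a * x)) 2 (gaussianReal 0 1) := by
  convert! (memLp_pow_mul_exp 1 a).sub ((memLp_exp a).const_mul a) using 1
  ext x
  simp [sub_mul]

theorem integral_exp (a : ℝ) :
    ∫ x, Real.exp (a * x) ∂gaussianReal 0 1 = Real.exp (a ^ 2 / 2) := by
  have := congrFun (mgf_fun_id_gaussianReal (μ := 0) (v := 1)) a
  simpa [mgf] using this

theorem integrable_gaussianPDFReal_mul {f : ℝ → ℝ} (hf : Integrable f (gaussianReal 0 1)) :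
    Integrable (fun x ↦ gaussianPDFReal 0 1 x * f x) := by
  rw [gaussianReal_of_var_ne_zero _ one_ne_zero,
    integrable_withDensity_iff_integrable_smul' (measurable_gaussianPDF 0 1)
      (ae_of_all _ fun _ ↦ gaussianPDF_lt_top)] at hf
  simpa using hf

theorem hasDerivAt_exp_mul_gaussianPDFReal (a x : ℝ) :
    HasDerivAt (fun x ↦ gaussianPDFReal 0 1 x * Real.exp (a * x))
      (gaussianPDFReal 0 1 x * ((a - x) * Real.exp (a * x))) x := by
  have h1 : HasDerivAt (fun x ↦ gaussianPDFReal 0 1 x) (gaussianPDFReal 0 1 x * (-x)) x := by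
    simp only [gaussianPDFReal_def]
    have : HasDerivAt (fun x : ℝ ↦ -(x - 0) ^ 2 / (2 * ((1 : NNReal) : ℝ))) (-x) x := by
      have := (((hasDerivAt_id x).sub_const 0).pow 2).neg.div_const (2 * ((1 : NNReal) : ℝ))
      convert! this using 1
      simp
      ring
    convert! (this.exp.const_mul _) using 1
    ring
  have h2 : HasDerivAt (fun x ↦ Real.exp (a * x)) (Real.exp (a * x) * a) x := by
    simpa using ((hasDerivAt_id x).const_mul a).exp
  convert! h1.mul h2 using 1
  ring

/-- If an integrable function `P` has an integrable primitive `Q`, its integral vanishes. -/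
theorem integral_eq_zero_of_forall_intervalIntegral_eq_sub {P Q : ℝ → ℝ} (hP : Integrable P)
    (hQ : Integrable Q) (h : ∀ a b, ∫ x in a..b, P x = Q b - Q a) : ∫ x, P x = 0 := by
  -- Integrability of `P` gives `Q` a limit; integrability of `Q` on a half-line of infinite measure
  -- makes that limit zero.
  have top : Tendsto Q atTop (𝓝 0) := by
    have h1 : Tendsto Q atTop (𝓝 (Q 0 + ∫ x in Ioi 0, P x)) := by
      have := (intervalIntegral_tendsto_integral_Ioi 0 hP.integrableOn tendsto_id).const_add (Q 0)
      simpa [h] using this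
    have h2 := IntegrableAtFilter.eq_zero_of_tendsto (hQ.integrableAtFilter atTop) (fun s hs ↦ by
      rcases mem_atTop_sets.1 hs with ⟨b, hb⟩
      rw [← top_le_iff, ← Real.volume_Ici (a := b)]
      exact measure_mono hb) h1
    rwa [h2] at h1
  have bot : Tendsto Q atBot (𝓝 0) := by
    have h1 : Tendsto Q atBot (𝓝 (Q 0 - ∫ x in Iic 0, P x)) := by
      have := (intervalIntegral_tendsto_integral_Iic 0 hP.integrableOn tendsto_id).const_sub (Q 0)
      simpa [h] using this
    have h2 := IntegrableAtFilter.eq_zero_of_tendsto (hQ.integrableAtFilter atBot) (fun s hs ↦ by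
      rcases mem_atBot_sets.1 hs with ⟨b, hb⟩
      rw [← top_le_iff, ← Real.volume_Iic (a := b)]
      exact measure_mono hb) h1
    rwa [h2] at h1
  have h1 := intervalIntegral_tendsto_integral hP tendsto_neg_atTop_atBot (tendsto_id (α := ℝ))
  have h2 : Tendsto (fun i ↦ ∫ x in (-i)..id i, P x) atTop (𝓝 (0 - 0)) := by
    simp only [h]
    exact top.sub (bot.comp tendsto_neg_atTop_atBot)
  rw [sub_zero] at h2
  exact tendsto_nhds_unique h1 h2

/-- Gaussian integration by parts against an exponential. -/
theorem integral_deriv_mul_exp {σ : ℝ → ℝ}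
    (hac : ∀ a b : ℝ, AbsolutelyContinuousOnInterval σ a b)
    (hσ' : MemLp (deriv σ) 2 (gaussianReal 0 1)) (hσ : MemLp σ 2 (gaussianReal 0 1)) (a : ℝ) :
    ∫ x, deriv σ x * Real.exp (a * x) ∂gaussianReal 0 1 =
      ∫ x, σ x * ((x - a) * Real.exp (a * x)) ∂gaussianReal 0 1 := by
  have i0 := hσ.integrable_mul (memLp_exp a)
  have i1 := hσ'.integrable_mul (memLp_exp a)
  have i2 := hσ.integrable_mul (memLp_sub_mul_exp a)
  have hw := hasDerivAt_exp_mul_gaussianPDFReal a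
  set w : ℝ → ℝ := fun x ↦ gaussianPDFReal 0 1 x * Real.exp (a * x)
  have hwac : ∀ b c, AbsolutelyContinuousOnInterval w b c := fun b c ↦ by
    apply ContDiffOn.absolutelyContinuousOnInterval
    apply ContDiff.contDiffOn
    simp only [w, gaussianPDFReal_def]
    fun_prop
  -- The integrand is `(σ w)'`, and `w' = (a - x) w`.
  have key := integral_eq_zero_of_forall_intervalIntegral_eq_sub
    (P := fun x ↦ deriv σ x * w x + σ x * deriv w x) (Q := fun x ↦ σ x * w x)
    (by
      refine ((integrable_gaussianPDFReal_mul i1).sub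
        (integrable_gaussianPDFReal_mul i2)).congr (ae_of_all _ fun x ↦ ?_)
      simp only [(hw x).deriv, w, Pi.mul_apply, Pi.sub_apply]
      ring)
    ((integrable_gaussianPDFReal_mul i0).congr (ae_of_all _ fun x ↦ by
      simp only [w, Pi.mul_apply]
      ring))
    (fun b c ↦ (hac b c).integral_deriv_mul_eq_sub (hwac b c))
  have hsub := integral_sub i1 i2
  simp only [Pi.mul_apply] at hsub
  rw [← sub_eq_zero, ← hsub, integral_gaussianReal_eq_integral_smul one_ne_zero]
  refine Eq.trans ?_ key
  congr 1
  ext x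
  simp only [(hw x).deriv, w, smul_eq_mul]
  ring

theorem integral_mul_exp (a : ℝ) :
    ∫ x, x * Real.exp (a * x) ∂gaussianReal 0 1 = a * Real.exp (a ^ 2 / 2) := by
  have h := integral_deriv_mul_exp (σ := fun _ ↦ 1)
    (fun b c ↦ contDiff_const.contDiffOn.absolutelyContinuousOnInterval)
    (by simp) (memLp_const 1) a
  have i1 : Integrable (fun x : ℝ ↦ x * Real.exp (a * x)) (gaussianReal 0 1) := by
    simpa using integrable_pow_mul_exp 1 a
  have i0 : Integrable (fun x : ℝ ↦ a * Real.exp (a * x)) (gaussianReal 0 1) :=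
    (by simpa using integrable_pow_mul_exp 0 a : Integrable _ _).const_mul a
  simp only [deriv_const', zero_mul, integral_zero, one_mul, sub_mul, integral_sub i1 i0,
    integral_const_mul, integral_exp] at h
  linarith

theorem integral_sq_mul_exp (a : ℝ) :
    ∫ x, x ^ 2 * Real.exp (a * x) ∂gaussianReal 0 1 = (1 + a ^ 2) * Real.exp (a ^ 2 / 2) := by
  have h := integral_deriv_mul_exp (σ := fun x ↦ x)
    (fun b c ↦ contDiff_id.contDiffOn.absolutelyContinuousOnInterval)
    (by simpa using memLp_const 1) (by simpa using memLp_pow_mul_exp 1 0) a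
  have i1 : Integrable (fun x : ℝ ↦ a * (x * Real.exp (a * x))) (gaussianReal 0 1) :=
    (by simpa using integrable_pow_mul_exp 1 a : Integrable _ _).const_mul a
  have e : ∀ x : ℝ, x * ((x - a) * Real.exp (a * x)) =
    x ^ 2 * Real.exp (a * x) - a * (x * Real.exp (a * x)) := fun x ↦ by ring
  simp only [e, deriv_id'', one_mul, integral_sub (integrable_pow_mul_exp 2 a) i1,
    integral_const_mul, integral_exp, integral_mul_exp] at h
  linarith

/-! ### Laplace transforms under the Gaussian measure. -/

/-- The measure with square integrable density `p` with respect to the standard Gaussian. -/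
noncomputable def gaussianWithDensity (p : ℝ → NNReal) : Measure ℝ :=
  (gaussianReal 0 1).withDensity fun x ↦ p x

theorem integral_gaussianWithDensity {p : ℝ → NNReal} (hp : Measurable p) (g : ℝ → ℝ) :
    ∫ x, g x ∂gaussianWithDensity p = ∫ x, p x * g x ∂gaussianReal 0 1 :=
  integral_withDensity_eq_integral_smul hp g

theorem integrableExpSet_gaussianWithDensity {p : ℝ → NNReal} (hp : Measurable p)
    (hp2 : MemLp (fun x ↦ (p x : ℝ)) 2 (gaussianReal 0 1)) :
    integrableExpSet id (gaussianWithDensity p) = univ := by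
  ext a
  simp only [integrableExpSet, mem_univ, iff_true, gaussianWithDensity]
  exact (integrable_withDensity_iff_integrable_smul hp).2 (hp2.integrable_mul (memLp_exp a))

theorem isFiniteMeasure_gaussianWithDensity {p : ℝ → NNReal} (hp : Measurable p)
    (hp2 : MemLp (fun x ↦ (p x : ℝ)) 2 (gaussianReal 0 1)) :
    IsFiniteMeasure (gaussianWithDensity p) := by
  have h : (0 : ℝ) ∈ integrableExpSet id (gaussianWithDensity p) := by
    simp [integrableExpSet_gaussianWithDensity hp hp2]
  have h' : Integrable (fun _ : ℝ ↦ (1 : ℝ)) (gaussianWithDensity p) := by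
    simpa [integrableExpSet] using h
  simpa [integrable_const_iff] using h'

theorem mgf_gaussianWithDensity {p : ℝ → NNReal} (hp : Measurable p) (a : ℝ) :
    mgf id (gaussianWithDensity p) a = ∫ x, p x * Real.exp (a * x) ∂gaussianReal 0 1 :=
  integral_gaussianWithDensity hp _

theorem hasDerivAt_integral_mul_exp_nnreal {p : ℝ → NNReal} (hp : Measurable p)
    (hp2 : MemLp (fun x ↦ (p x : ℝ)) 2 (gaussianReal 0 1)) (a : ℝ) :
    HasDerivAt (fun b ↦ ∫ x, p x * Real.exp (b * x) ∂gaussianReal 0 1)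
      (∫ x, p x * (x * Real.exp (a * x)) ∂gaussianReal 0 1) a := by
  have h := hasDerivAt_mgf (X := id) (μ := gaussianWithDensity p) (t := a)
    (by simp [integrableExpSet_gaussianWithDensity hp hp2])
  rw [integral_gaussianWithDensity hp] at h
  exact h.congr_of_eventuallyEq (Eventually.of_forall fun b ↦ (mgf_gaussianWithDensity hp b).symm)

theorem memLp_toNNReal {f : ℝ → ℝ} (hf : MemLp f 2 (gaussianReal 0 1)) :
    MemLp (fun x ↦ ((f x).toNNReal : ℝ)) 2 (gaussianReal 0 1) := by
  simpa only [Real.coe_toNNReal'] using hf.pos_part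

/-- Reduces a signed density to two positive ones, whose Laplace transforms are moment generating
functions of finite measures. -/
theorem integral_mul_eq_sub_toNNReal {f g : ℝ → ℝ} (hf : MemLp f 2 (gaussianReal 0 1))
    (hg : MemLp g 2 (gaussianReal 0 1)) :
    ∫ x, f x * g x ∂gaussianReal 0 1 =
      (∫ x, (f x).toNNReal * g x ∂gaussianReal 0 1) -
        ∫ x, (-f x).toNNReal * g x ∂gaussianReal 0 1 := by
  have h := integral_sub ((memLp_toNNReal hf).integrable_mul hg)
    ((memLp_toNNReal hf.neg).integrable_mul hg)
  simp only [Pi.mul_apply, Pi.neg_apply] at h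
  rw [← h]
  congr 1
  ext x
  rw [← sub_mul]
  congr 1
  rcases le_total 0 (f x) with h | h <;> simp [h]

/-- The Laplace transform of `f` under the Gaussian measure can be differentiated under the
integral sign. -/
theorem hasDerivAt_integral_mul_exp {f : ℝ → ℝ} (hfm : Measurable f)
    (hf : MemLp f 2 (gaussianReal 0 1)) (a : ℝ) :
    HasDerivAt (fun b ↦ ∫ x, f x * Real.exp (b * x) ∂gaussianReal 0 1)
      (∫ x, f x * (x * Real.exp (a * x)) ∂gaussianReal 0 1) a := by
  have h := (hasDerivAt_integral_mul_exp_nnreal hfm.real_toNNReal (memLp_toNNReal hf) a).sub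
    (hasDerivAt_integral_mul_exp_nnreal hfm.neg.real_toNNReal (memLp_toNNReal hf.neg) a)
  rw [integral_mul_eq_sub_toNNReal hf (by simpa using memLp_pow_mul_exp 1 a)]
  exact h.congr_of_eventuallyEq
    (Eventually.of_forall fun b ↦ integral_mul_eq_sub_toNNReal hf (memLp_exp b))

/-- A square integrable function with vanishing Laplace transform under the Gaussian measure
vanishes. -/
theorem ae_eq_zero_of_forall_integral_mul_exp_eq_zero {f : ℝ → ℝ} (hfm : Measurable f)
    (hf : MemLp f 2 (gaussianReal 0 1))
    (h : ∀ a, ∫ x, f x * Real.exp (a * x) ∂gaussianReal 0 1 = 0) :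
    f =ᵐ[gaussianReal 0 1] 0 := by
  have m1 := hfm.real_toNNReal
  have m2 := hfm.neg.real_toNNReal
  have L1 := memLp_toNNReal hf
  have L2 := memLp_toNNReal hf.neg
  have := isFiniteMeasure_gaussianWithDensity m1 L1
  have := isFiniteMeasure_gaussianWithDensity m2 L2
  have hmgf : mgf id (gaussianWithDensity fun x ↦ (f x).toNNReal) =
      mgf id (gaussianWithDensity fun x ↦ ((-f) x).toNNReal) := by
    ext a
    have := h a
    rw [integral_mul_eq_sub_toNNReal hf (memLp_exp a), sub_eq_zero] at this
    rw [mgf_gaussianWithDensity m1, mgf_gaussianWithDensity m2]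
    exact this
  have hzero : gaussianWithDensity (fun x ↦ (f x).toNNReal) = 0 ↔
      gaussianWithDensity (fun x ↦ ((-f) x).toNNReal) = 0 := by
    have := congrFun hmgf 0
    simp only [mgf_zero'] at this
    rw [← Measure.measure_univ_eq_zero, ← Measure.measure_univ_eq_zero,
      ← measureReal_eq_zero_iff, ← measureReal_eq_zero_iff, this]
  -- Equality of the mgfs continues analytically to the complex plane, which identifies the two
  -- measures.
  have hc := eqOn_complexMGF_of_mgf' hmgf hzero
  rw [integrableExpSet_gaussianWithDensity m1 L1] at hc
  have heq := Measure.ext_of_complexMGF_id_eq (funext fun z ↦ hc (by simp))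
  rw [gaussianWithDensity, gaussianWithDensity, withDensity_eq_iff_of_sigmaFinite
    (by fun_prop) (by fun_prop)] at heq
  filter_upwards [heq] with x hx
  have hx' : (f x).toNNReal = (-f x).toNNReal := by simpa using hx
  rcases le_total 0 (f x) with h0 | h0
  · rw [Real.toNNReal_of_nonpos (r := -f x) (by linarith), Real.toNNReal_eq_zero] at hx'
    exact le_antisymm hx' h0
  · rw [Real.toNNReal_of_nonpos h0, eq_comm, Real.toNNReal_eq_zero] at hx'
    exact le_antisymm h0 (by simpa using hx')

/-- A square integrable function orthogonal to all `(x - a) exp (a x)` is constant. -/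
theorem ae_eq_const_of_forall_integral_eq_zero {f : ℝ → ℝ} (hfm : Measurable f)
    (hf : MemLp f 2 (gaussianReal 0 1))
    (h : ∀ a, ∫ x, f x * ((x - a) * Real.exp (a * x)) ∂gaussianReal 0 1 = 0) :
    f =ᵐ[gaussianReal 0 1] fun _ ↦ ∫ x, f x ∂gaussianReal 0 1 := by
  set F : ℝ → ℝ := fun b ↦ ∫ x, f x * Real.exp (b * x) ∂gaussianReal 0 1 with hF
  have hF0 : F 0 = ∫ x, f x ∂gaussianReal 0 1 := by simp [hF]
  -- The orthogonality hypothesis is the equation `F' = a F`, so `F a = F 0 * exp (a² / 2)`: the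
  -- transform of the constant `F 0`.
  have hd : ∀ a, HasDerivAt F (a * F a) a := fun a ↦ by
    convert! hasDerivAt_integral_mul_exp hfm hf a using 1
    have i1 := hf.integrable_mul (by simpa using memLp_pow_mul_exp 1 a :
      MemLp (fun x : ℝ ↦ x * Real.exp (a * x)) 2 (gaussianReal 0 1))
    have i0 := (hf.integrable_mul (memLp_exp a)).const_mul a
    have h2 := integral_sub i1 i0
    simp only [Pi.mul_apply, integral_const_mul] at h2
    rw [eq_comm, ← sub_eq_zero, hF, ← h2]
    refine Eq.trans ?_ (h a)
    congr 1
    ext x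
    ring
  have hc : ∀ a, F a * Real.exp (-(a ^ 2 / 2)) = F 0 := fun a ↦ by
    have hG : ∀ b, HasDerivAt (fun b ↦ F b * Real.exp (-(b ^ 2 / 2))) 0 b := fun b ↦ by
      have h1 : HasDerivAt (fun b : ℝ ↦ -(b ^ 2 / 2)) (-b) b := by
        convert! ((hasDerivAt_pow 2 b).div_const 2).neg using 1
        simp
      convert! (hd b).mul h1.exp using 1
      ring
    simpa using is_const_of_deriv_eq_zero (fun b ↦ (hG b).differentiableAt)
      (fun b ↦ (hG b).deriv) a 0
  have hz := ae_eq_zero_of_forall_integral_mul_exp_eq_zero (f := fun x ↦ f x - F 0)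
    (hfm.sub_const _) (hf.sub (memLp_const _)) fun a ↦ by
      have h2 := integral_sub (hf.integrable_mul (memLp_exp a))
        (((memLp_exp a).integrable one_le_two).const_mul (F 0))
      simp only [Pi.mul_apply, integral_const_mul, integral_exp] at h2
      simp only [sub_mul, h2]
      rw [← hc a, mul_assoc, ← Real.exp_add]
      simp [hF]
  filter_upwards [hz] with x hx
  rw [← hF0]
  exact sub_eq_zero.1 hx

/-! ### Density of exponentials and the Poincaré inequality. -/

/-- The function `exp (a x)` as an element of `L²` of the standard Gaussian. -/
noncomputable def expLp (a : ℝ) : Lp ℝ 2 (gaussianReal 0 1) := (memLp_exp a).toLp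

/-- The function `(x - a) exp (a x)` as an element of `L²` of the standard Gaussian. -/
noncomputable def subMulExpLp (a : ℝ) : Lp ℝ 2 (gaussianReal 0 1) := (memLp_sub_mul_exp a).toLp

theorem inner_sum_smul_sum_smul {E ι : Type*} [NormedAddCommGroup E] [InnerProductSpace ℝ E]
    (s : Finset ι) (c : ι → ℝ) (u v : ι → E) :
    ⟪∑ i ∈ s, c i • u i, ∑ j ∈ s, c j • v j⟫ = ∑ i ∈ s, ∑ j ∈ s, c i * c j * ⟪u i, v j⟫ := by
  rw [sum_inner]
  simp only [inner_sum, real_inner_smul_left, real_inner_smul_right]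
  exact Finset.sum_congr rfl fun i _ ↦ Finset.sum_congr rfl fun j _ ↦ by ring

theorem inner_expLp (a b : ℝ) : ⟪expLp a, expLp b⟫ = Real.exp ((a + b) ^ 2 / 2) := by
  rw [expLp, expLp, inner_toLp, ← integral_exp]
  simp only [← Real.exp_add, add_mul]

theorem inner_subMulExpLp (a b : ℝ) :
    ⟪subMulExpLp a, subMulExpLp b⟫ = (1 + a * b) * ⟪expLp a, expLp b⟫ := by
  rw [inner_expLp, subMulExpLp, subMulExpLp, inner_toLp]
  have i0 : Integrable (fun x : ℝ ↦ Real.exp ((a + b) * x)) (gaussianReal 0 1) :=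
    (memLp_exp (a + b)).integrable one_le_two
  have i1 : Integrable (fun x : ℝ ↦ x * Real.exp ((a + b) * x)) (gaussianReal 0 1) := by
    simpa using integrable_pow_mul_exp 1 (a + b)
  have i2 := integrable_pow_mul_exp 2 (a + b)
  have i12 : Integrable (fun x : ℝ ↦ x ^ 2 * Real.exp ((a + b) * x) -
      (a + b) * (x * Real.exp ((a + b) * x))) (gaussianReal 0 1) := i2.sub (i1.const_mul _)
  have e : ∀ x : ℝ, (x - a) * Real.exp (a * x) * ((x - b) * Real.exp (b * x)) =
      x ^ 2 * Real.exp ((a + b) * x) - (a + b) * (x * Real.exp ((a + b) * x)) +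
        a * b * Real.exp ((a + b) * x) := fun x ↦ by
    rw [add_mul, Real.exp_add]
    ring
  simp only [e]
  rw [integral_add i12 (i0.const_mul _), integral_sub i2 (i1.const_mul _),
    integral_const_mul, integral_const_mul, integral_exp, integral_mul_exp, integral_sq_mul_exp]
  ring

/-- By `inner_subMulExpLp`, the difference of the squared norms is `‖∑ c a * a • expLp a‖²`. -/
theorem norm_sum_expLp_le (s : Finset ℝ) (c : ℝ → ℝ) :
    ‖∑ a ∈ s, c a • expLp a‖ ≤ ‖∑ a ∈ s, c a • subMulExpLp a‖ := by
  rw [← sq_le_sq₀ (norm_nonneg _) (norm_nonneg _), ← real_inner_self_eq_norm_sq,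
    ← real_inner_self_eq_norm_sq]
  have h := inner_sum_smul_sum_smul s (fun a ↦ c a * a) expLp expLp
  have h0 := real_inner_self_nonneg (x := ∑ a ∈ s, (c a * a) • expLp a)
  rw [h] at h0
  rw [inner_sum_smul_sum_smul, inner_sum_smul_sum_smul, ← sub_nonneg]
  refine h0.trans_eq ?_
  rw [← Finset.sum_sub_distrib]
  refine Finset.sum_congr rfl fun a _ ↦ ?_
  rw [← Finset.sum_sub_distrib]
  refine Finset.sum_congr rfl fun b _ ↦ ?_
  rw [inner_subMulExpLp]
  ring

theorem integral_mul_Lp_eq_inner {f : ℝ → ℝ} (g : Lp ℝ 2 (gaussianReal 0 1))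
    (hf : MemLp f 2 (gaussianReal 0 1)) :
    ∫ x, g x * f x ∂gaussianReal 0 1 = ⟪g, hf.toLp f⟫ := by
  rw [← inner_toLp (Lp.memLp g) hf, Lp.toLp_coeFn]

theorem dense_span_expLp :
    Dense (Submodule.span ℝ (range expLp) : Set (Lp ℝ 2 (gaussianReal 0 1))) := by
  rw [Submodule.dense_iff_topologicalClosure_eq_top, Submodule.topologicalClosure_eq_top_iff,
    Submodule.eq_bot_iff]
  intro g hg
  rw [Submodule.mem_orthogonal'] at hg
  rw [Lp.eq_zero_iff_ae_eq_zero]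
  refine ae_eq_zero_of_forall_integral_mul_exp_eq_zero (Lp.stronglyMeasurable g).measurable
    (Lp.memLp g) fun a ↦ ?_
  rw [integral_mul_Lp_eq_inner g (memLp_exp a)]
  exact hg _ (Submodule.subset_span ⟨a, rfl⟩)

/-- The orthogonal complement of the span consists of constants, to which a mean-zero `f` is
orthogonal. -/
theorem mem_closure_span_subMulExpLp {f : ℝ → ℝ} (hf : MemLp f 2 (gaussianReal 0 1))
    (h0 : ∫ x, f x ∂gaussianReal 0 1 = 0) :
    hf.toLp f ∈ (Submodule.span ℝ (range subMulExpLp)).topologicalClosure := by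
  rw [← Submodule.orthogonal_orthogonal_eq_closure, Submodule.mem_orthogonal]
  intro g hg
  rw [Submodule.mem_orthogonal'] at hg
  have hc := ae_eq_const_of_forall_integral_eq_zero (Lp.stronglyMeasurable g).measurable
    (Lp.memLp g) fun a ↦ by
      rw [integral_mul_Lp_eq_inner g (memLp_sub_mul_exp a)]
      exact hg _ (Submodule.subset_span ⟨a, rfl⟩)
  rw [← integral_mul_Lp_eq_inner g hf]
  calc _ = ∫ x, (∫ y, g y ∂gaussianReal 0 1) * f x ∂gaussianReal 0 1 := by
        apply integral_congr_ae
        filter_upwards [hc] with x hx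
        rw [hx]
    _ = 0 := by rw [integral_const_mul, h0, mul_zero]

/-- The Gaussian Poincaré inequality. -/
theorem integral_sq_le_integral_deriv_sq {σ : ℝ → ℝ}
    (hac : ∀ a b : ℝ, AbsolutelyContinuousOnInterval σ a b)
    (hσ' : MemLp (deriv σ) 2 (gaussianReal 0 1)) (hσ : MemLp σ 2 (gaussianReal 0 1))
    (h0 : ∫ x, σ x ∂gaussianReal 0 1 = 0) :
    ∫ x, σ x ^ 2 ∂gaussianReal 0 1 ≤ ∫ x, deriv σ x ^ 2 ∂gaussianReal 0 1 := by
  set S := hσ.toLp σ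
  set S' := hσ'.toLp (deriv σ)
  have e1 : ∫ x, σ x ^ 2 ∂gaussianReal 0 1 = ‖S‖ ^ 2 := by
    rw [← real_inner_self_eq_norm_sq, inner_toLp]
    simp only [sq]
  have e2 : ∫ x, deriv σ x ^ 2 ∂gaussianReal 0 1 = ‖S'‖ ^ 2 := by
    rw [← real_inner_self_eq_norm_sq, inner_toLp]
    simp only [sq]
  -- Duality: integration by parts turns `⟪S, v⟫` into a pairing of `S'` with the corresponding sum
  -- of exponentials, whose norm is at most `‖v‖`. The case `v = S` gives the inequality.
  have hbound : ∀ v ∈ (Submodule.span ℝ (range subMulExpLp)).topologicalClosure,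
      ⟪S, v⟫ ≤ ‖S'‖ * ‖v‖ := by
    intro v hv
    rw [← SetLike.mem_coe, Submodule.topologicalClosure_coe] at hv
    refine closure_minimal (s := (Submodule.span ℝ (range subMulExpLp) : Set _))
      (t := {v | ⟪S, v⟫ ≤ ‖S'‖ * ‖v‖}) ?_
      (isClosed_le (by fun_prop) (by fun_prop)) hv
    intro v hv
    rw [SetLike.mem_coe, Finsupp.mem_span_range_iff_exists_finsupp] at hv
    obtain ⟨c, rfl⟩ := hv
    simp only [Finsupp.sum, mem_ofPred_eq]
    refine le_trans ?_ (mul_le_mul_of_nonneg_left (norm_sum_expLp_le c.support c)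
      (norm_nonneg S'))
    refine le_trans (le_of_eq ?_) (real_inner_le_norm _ _)
    simp only [inner_sum, real_inner_smul_right]
    refine Finset.sum_congr rfl fun a _ ↦ ?_
    congr 1
    simp only [S, S', subMulExpLp, expLp, inner_toLp]
    exact (integral_deriv_mul_exp hac hσ' hσ a).symm
  have h := hbound S (mem_closure_span_subMulExpLp hσ h0)
  rw [real_inner_self_eq_norm_sq] at h
  rw [e1, e2]
  nlinarith [sq_nonneg (‖S‖ - ‖S'‖)]

/-! ### The dual activation as a quadratic form on `L²`. -/

/-- A standard Gaussian variable with correlation `t` to the first coordinate. -/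
noncomputable def correlate (t : ℝ) (z : ℝ × ℝ) : ℝ := t * z.1 + √(1 - t ^ 2) * z.2

theorem measurePreserving_correlate {t : ℝ} (ht : |t| ≤ 1) :
    MeasurePreserving (correlate t) ((gaussianReal 0 1).prod (gaussianReal 0 1))
      (gaussianReal 0 1) := by
  refine ⟨by unfold correlate; fun_prop, ?_⟩
  have hind : IndepFun (fun z : ℝ × ℝ ↦ t * z.1) (fun z : ℝ × ℝ ↦ √(1 - t ^ 2) * z.2)
      ((gaussianReal 0 1).prod (gaussianReal 0 1)) :=
    indepFun_prod (X := fun x ↦ t * x) (Y := fun x ↦ √(1 - t ^ 2) * x) (by fun_prop) (by fun_prop)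
  have h1 : ((gaussianReal 0 1).prod (gaussianReal 0 1)).map (fun z : ℝ × ℝ ↦ t * z.1) =
      gaussianReal (t * 0) (.mk (t ^ 2) (sq_nonneg _) * 1) := by
    rw [← gaussianReal_map_const_mul t, ← Function.comp_def (fun x ↦ t * x) Prod.fst,
      ← Measure.map_map (by fun_prop) measurable_fst, measurePreserving_fst.map_eq]
  have h2 : ((gaussianReal 0 1).prod (gaussianReal 0 1)).map
      (fun z : ℝ × ℝ ↦ √(1 - t ^ 2) * z.2) =
      gaussianReal (√(1 - t ^ 2) * 0) (.mk (√(1 - t ^ 2) ^ 2) (sq_nonneg _) * 1) := by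
    rw [← gaussianReal_map_const_mul, ← Function.comp_def (fun x ↦ √(1 - t ^ 2) * x) Prod.snd,
      ← Measure.map_map (by fun_prop) measurable_snd, measurePreserving_snd.map_eq]
  have h := gaussianReal_add_gaussianReal_of_indepFun hind h1 h2
  refine Eq.trans h ?_
  congr 1
  · simp
  · ext
    have : √(1 - t ^ 2) ^ 2 = 1 - t ^ 2 := by
      rw [Real.sq_sqrt]
      have := (sq_le_one_iff_abs_le_one t).2 ht
      linarith
    push_cast
    simp [this]

/-- The bilinear form `E[f(X) g(Y)]` for standard Gaussians `X`, `Y` with correlation `t`. -/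
noncomputable def dualForm {t : ℝ} (ht : |t| ≤ 1) (f g : Lp ℝ 2 (gaussianReal 0 1)) : ℝ :=
  ⟪Lp.compMeasurePreservingₗᵢ ℝ Prod.fst
      (measurePreserving_fst (μ := gaussianReal 0 1) (ν := gaussianReal 0 1)) f,
    Lp.compMeasurePreservingₗᵢ ℝ (correlate t) (measurePreserving_correlate ht) g⟫

theorem dualForm_toLp {t : ℝ} (ht : |t| ≤ 1) {f g : ℝ → ℝ} (hf : MemLp f 2 (gaussianReal 0 1))
    (hg : MemLp g 2 (gaussianReal 0 1)) :
    dualForm ht (hf.toLp f) (hg.toLp g) = ∫ z : ℝ × ℝ, f z.1 * g (t * z.1 + √(1 - t ^ 2) * z.2)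
      ∂((gaussianReal 0 1).prod (gaussianReal 0 1)) :=
  inner_toLp (hf.comp_measurePreserving measurePreserving_fst)
    (hg.comp_measurePreserving (measurePreserving_correlate ht))

theorem dualActivation_eq_dualForm {t : ℝ} (ht : |t| ≤ 1) {f : ℝ → ℝ}
    (hf : MemLp f 2 (gaussianReal 0 1)) :
    dualActivation f t = dualForm ht (hf.toLp f) (hf.toLp f) :=
  (dualForm_toLp ht hf hf).symm

theorem continuous_dualForm_self {t : ℝ} (ht : |t| ≤ 1) :
    Continuous fun f ↦ dualForm ht f f := by
  unfold dualForm
  fun_prop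

theorem dualForm_expLp {t : ℝ} (ht : |t| ≤ 1) (a b : ℝ) :
    dualForm ht (expLp a) (expLp b) =
      Real.exp (a ^ 2 / 2) * Real.exp (b ^ 2 / 2) * Real.exp (t * (a * b)) := by
  have hs : √(1 - t ^ 2) ^ 2 = 1 - t ^ 2 := by
    rw [Real.sq_sqrt]
    have := (sq_le_one_iff_abs_le_one t).2 ht
    linarith
  have e : ∀ z : ℝ × ℝ, Real.exp (a * z.1) * Real.exp (b * (t * z.1 + √(1 - t ^ 2) * z.2)) =
      Real.exp ((a + b * t) * z.1) * Real.exp ((b * √(1 - t ^ 2)) * z.2) := fun z ↦ by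
    rw [← Real.exp_add, ← Real.exp_add]
    ring_nf
  rw [expLp, expLp, dualForm_toLp]
  simp only [e]
  rw [integral_prod_mul (fun x ↦ Real.exp ((a + b * t) * x))
    (fun x ↦ Real.exp ((b * √(1 - t ^ 2)) * x)), integral_exp, integral_exp, ← Real.exp_add,
    ← Real.exp_add, ← Real.exp_add, mul_pow, hs]
  ring_nf

theorem dualForm_sum {t : ℝ} (ht : |t| ≤ 1) (s : Finset ℝ) (c : ℝ → ℝ) :
    dualForm ht (∑ a ∈ s, c a • expLp a) (∑ a ∈ s, c a • expLp a) =
      ∑ a ∈ s, ∑ b ∈ s, c a * c b * dualForm ht (expLp a) (expLp b) := by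
  simp only [dualForm, map_sum, map_smul]
  exact inner_sum_smul_sum_smul s c _ _

/-- The square of this coefficient, divided by `m!`, is the weight of the `m`-th Hermite
polynomial in the linear combination `∑ c a exp (a x)`. -/
noncomputable def expCoeff (s : Finset ℝ) (c : ℝ → ℝ) (m : ℕ) : ℝ :=
  ∑ a ∈ s, c a * (a ^ m * Real.exp (a ^ 2 / 2))

/-- Expand `exp (t a b)` in powers of `t`: the double sum at `t^m` factors into a square, so all
coefficients are nonnegative. -/
theorem hasSum_dualForm {t : ℝ} (ht : |t| ≤ 1) (s : Finset ℝ) (c : ℝ → ℝ) :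
    HasSum (fun m : ℕ ↦ t ^ m * (expCoeff s c m ^ 2 / m.factorial))
      (dualForm ht (∑ a ∈ s, c a • expLp a) (∑ a ∈ s, c a • expLp a)) := by
  rw [dualForm_sum]
  have h : HasSum (fun m : ℕ ↦ ∑ a ∈ s, ∑ b ∈ s, c a * c b *
      (Real.exp (a ^ 2 / 2) * Real.exp (b ^ 2 / 2) * ((t * (a * b)) ^ m / m.factorial)))
      (∑ a ∈ s, ∑ b ∈ s, c a * c b * dualForm ht (expLp a) (expLp b)) := by
    refine hasSum_sum fun a _ ↦ hasSum_sum fun b _ ↦ ?_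
    rw [dualForm_expLp]
    refine HasSum.mul_left _ (HasSum.mul_left _ ?_)
    rw [Real.exp_eq_exp_ℝ]
    exact NormedSpace.expSeries_div_hasSum_exp _
  convert! h using 2 with m
  rw [expCoeff, sq, Finset.sum_mul_sum, Finset.sum_div, Finset.mul_sum]
  refine Finset.sum_congr rfl fun a _ ↦ ?_
  rw [Finset.sum_div, Finset.mul_sum]
  refine Finset.sum_congr rfl fun b _ ↦ ?_
  rw [mul_pow, mul_pow]
  ring

theorem dualForm_one (f g : Lp ℝ 2 (gaussianReal 0 1)) :
    dualForm (t := 1) (by simp) f g = ⟪f, g⟫ := by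
  -- Quantifying over the proof `hc` allows `correlate 1` to be rewritten inside a dependent type.
  have h : ∀ hc, Lp.compMeasurePreservingₗᵢ (E := ℝ) (p := 2) ℝ (correlate 1) hc =
      Lp.compMeasurePreservingₗᵢ ℝ Prod.fst
        (measurePreserving_fst (μ := gaussianReal 0 1) (ν := gaussianReal 0 1)) := by
    have : correlate 1 = Prod.fst := by
      ext z
      simp [correlate]
    rw [this]
    exact fun _ ↦ rfl
  rw [dualForm, h, LinearIsometry.inner_map_map]

/-- Keep the first one or two terms and bound the later powers by `|t|` or `t²`, respectively. -/
theorem abs_le_of_hasSum_pow_mul {p : ℕ → ℝ} (hp : ∀ m, 0 ≤ p m) {N D t : ℝ} (ht : |t| ≤ 1)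
    (hN : HasSum p N) (hD : HasSum (fun m ↦ t ^ m * p m) D) :
    |D| ≤ p 0 + (N - p 0) * |t| ∧ |D| ≤ p 0 + p 1 * |t| + (N - p 0 - p 1) * t ^ 2 := by
  have ht0 := abs_nonneg t
  have h0 : ∀ a : ℝ, HasSum (fun m : ℕ ↦ if m = 0 then a else 0) a := fun a ↦ hasSum_ite_eq 0 a
  have h1 : ∀ a : ℝ, HasSum (fun m : ℕ ↦ if m = 1 then a else 0) a := fun a ↦ hasSum_ite_eq 1 a
  rw [← hD.tsum_eq, ← Real.norm_eq_abs]
  constructor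
  · refine tsum_of_norm_bounded (g := fun m ↦ p m * |t| + if m = 0 then p 0 * (1 - |t|) else 0)
      ?_ fun m ↦ ?_
    · convert! (hN.mul_right |t|).add (h0 (p 0 * (1 - |t|))) using 1
      ring
    · rw [Real.norm_eq_abs, abs_mul, abs_pow, abs_of_nonneg (hp m), mul_comm]
      rcases m with _ | m
      · simp
        linarith
      · simp only [Nat.add_eq_zero_iff, one_ne_zero, and_false, if_false, add_zero]
        exact mul_le_mul_of_nonneg_left (pow_le_of_le_one ht0 ht (by simp)) (hp _)
  · refine tsum_of_norm_bounded (g := fun m ↦ (p m * t ^ 2 +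
      if m = 0 then p 0 * (1 - t ^ 2) else 0) + if m = 1 then p 1 * (|t| - t ^ 2) else 0)
      ?_ fun m ↦ ?_
    · convert! ((hN.mul_right (t ^ 2)).add (h0 (p 0 * (1 - t ^ 2)))).add
        (h1 (p 1 * (|t| - t ^ 2))) using 1
      ring
    · rw [Real.norm_eq_abs, abs_mul, abs_pow, abs_of_nonneg (hp m), mul_comm, ← sq_abs t]
      rcases m with _ | _ | m
      · simp
        linarith
      · simp
        linarith
      · simp only [Nat.add_eq_zero_iff, one_ne_zero, and_false, if_false, add_zero,
          Nat.add_eq_right]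
        exact mul_le_mul_of_nonneg_left (pow_le_pow_of_le_one ht0 ht (by omega)) (hp _)

/-- The function `x` as an element of `L²` of the standard Gaussian. -/
noncomputable def idLp : Lp ℝ 2 (gaussianReal 0 1) :=
  MemLp.toLp (fun x : ℝ ↦ x) (memLp_id_gaussianReal' 2 (by simp))

theorem inner_expLp_zero_sum (s : Finset ℝ) (c : ℝ → ℝ) :
    ⟪expLp 0, ∑ a ∈ s, c a • expLp a⟫ = expCoeff s c 0 := by
  simp [inner_sum, real_inner_smul_right, inner_expLp, expCoeff]

theorem inner_idLp_sum (s : Finset ℝ) (c : ℝ → ℝ) :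
    ⟪idLp, ∑ a ∈ s, c a • expLp a⟫ = expCoeff s c 1 := by
  simp only [inner_sum, real_inner_smul_right, expCoeff, pow_one]
  refine Finset.sum_congr rfl fun a _ ↦ ?_
  rw [idLp, expLp, inner_toLp, integral_mul_exp]

/-- The weights of degree `0` and `1` are the squared pairings with `1` and `x`, and the total
weight is the form at `t = 1`. All terms are continuous in `f`, so combinations of exponentials
suffice. -/
theorem abs_dualForm_le {t : ℝ} (ht : |t| ≤ 1) (f : Lp ℝ 2 (gaussianReal 0 1)) :
    |dualForm ht f f| ≤ ⟪expLp 0, f⟫ ^ 2 + (⟪f, f⟫ - ⟪expLp 0, f⟫ ^ 2) * |t| ∧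
    |dualForm ht f f| ≤ ⟪expLp 0, f⟫ ^ 2 + ⟪idLp, f⟫ ^ 2 * |t| +
      (⟪f, f⟫ - ⟪expLp 0, f⟫ ^ 2 - ⟪idLp, f⟫ ^ 2) * t ^ 2 := by
  have hc := continuous_dualForm_self ht
  refine dense_span_expLp.induction (P := fun f ↦
    |dualForm ht f f| ≤ ⟪expLp 0, f⟫ ^ 2 + (⟪f, f⟫ - ⟪expLp 0, f⟫ ^ 2) * |t| ∧
    |dualForm ht f f| ≤ ⟪expLp 0, f⟫ ^ 2 + ⟪idLp, f⟫ ^ 2 * |t| +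
      (⟪f, f⟫ - ⟪expLp 0, f⟫ ^ 2 - ⟪idLp, f⟫ ^ 2) * t ^ 2) (fun u hu ↦ ?_)
    ((isClosed_le hc.abs (by fun_prop)).inter (isClosed_le hc.abs (by fun_prop))) f
  rw [SetLike.mem_coe, Finsupp.mem_span_range_iff_exists_finsupp] at hu
  obtain ⟨c, rfl⟩ := hu
  simp only [Finsupp.sum]
  have hN := hasSum_dualForm (t := 1) (by simp) c.support c
  simp only [one_pow, one_mul, dualForm_one] at hN
  have h := abs_le_of_hasSum_pow_mul (fun m ↦ by positivity) ht hN
    (hasSum_dualForm ht c.support c)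
  simpa only [Nat.factorial_zero, Nat.factorial_one, Nat.cast_one, div_one,
    ← inner_expLp_zero_sum, ← inner_idLp_sum] using h

/-! ### Contraction bounds for the duals of `σ` and `σ'`. -/

theorem expLp_zero_inner_toLp {f : ℝ → ℝ} (hf : MemLp f 2 (gaussianReal 0 1)) :
    ⟪expLp 0, hf.toLp f⟫ = ∫ x, f x ∂gaussianReal 0 1 := by
  rw [expLp, inner_toLp]
  simp

theorem toLp_inner_self {f : ℝ → ℝ} (hf : MemLp f 2 (gaussianReal 0 1)) :
    ⟪hf.toLp f, hf.toLp f⟫ = ∫ x, f x ^ 2 ∂gaussianReal 0 1 := by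
  rw [inner_toLp]
  simp only [sq]

theorem dualActivation_one {f : ℝ → ℝ} (hf : MemLp f 2 (gaussianReal 0 1)) :
    dualActivation f 1 = ∫ x, f x ^ 2 ∂gaussianReal 0 1 := by
  rw [dualActivation_eq_dualForm (by simp) hf, dualForm_one, toLp_inner_self]

variable {σ : ℝ → ℝ}

theorem IsNormalizedActivation.nonlinearity_le_one : nonlinearity σ ≤ 1 := by
  have := sq_nonneg (∫ z, z * σ z ∂gaussianReal 0 1)
  unfold nonlinearity
  linarith

theorem IsNormalizedActivation.abs_dualActivation_le (hσ : IsNormalizedActivation σ) {t : ℝ}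
    (ht : |t| ≤ 1) :
    |dualActivation σ t| ≤ |t| * (1 - nonlinearity σ * (1 - |t|)) := by
  have h := (abs_dualForm_le ht (hσ.memLp.toLp σ)).2
  rw [← dualActivation_eq_dualForm, expLp_zero_inner_toLp, toLp_inner_self, hσ.mean_eq_zero,
    hσ.second_moment_eq_one, idLp, inner_toLp, ← sq_abs t] at h
  refine h.trans_eq ?_
  unfold nonlinearity
  ring

theorem IsNormalizedActivation.dualActivation_one (hσ : IsNormalizedActivation σ) :
    dualActivation σ 1 = 1 := by
  rw [DeepNTK.dualActivation_one hσ.memLp, hσ.second_moment_eq_one]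

theorem IsNormalizedActivation.one_le_dualActivation_deriv_one (hσ : IsNormalizedActivation σ) :
    1 ≤ dualActivation (deriv σ) 1 := by
  rw [DeepNTK.dualActivation_one hσ.deriv_memLp, ← hσ.second_moment_eq_one]
  exact integral_sq_le_integral_deriv_sq hσ.absCont hσ.deriv_memLp hσ.memLp hσ.mean_eq_zero

theorem IsNormalizedActivation.abs_dualActivation_deriv_le (hσ : IsNormalizedActivation σ)
    {t : ℝ} (ht : |t| ≤ 1) :
    |dualActivation (deriv σ) t| ≤
      dualActivation (deriv σ) 1 * (1 - nonlinearity σ * (1 - |t|)) := by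
  have h := (abs_dualForm_le ht (hσ.deriv_memLp.toLp (deriv σ))).1
  have hst := integral_deriv_mul_exp hσ.absCont hσ.deriv_memLp hσ.memLp 0
  have hs := hσ.one_le_dualActivation_deriv_one
  rw [← dualActivation_eq_dualForm, expLp_zero_inner_toLp, toLp_inner_self,
    ← DeepNTK.dualActivation_one hσ.deriv_memLp] at h
  simp only [zero_mul, Real.exp_zero, mul_one, sub_zero, mul_comm (σ _)] at hst
  rw [hst] at h
  have hb : (∫ z, z * σ z ∂gaussianReal 0 1) ^ 2 = 1 - nonlinearity σ := by
    unfold nonlinearity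
    ring
  rw [hb] at h
  have hμ := IsNormalizedActivation.nonlinearity_le_one (σ := σ)
  -- With `S` the dual of `σ'` at `1`, the gap between the two bounds is exactly `(1 - μ) (1 - |t|)
  -- (S - 1)`.
  nlinarith [mul_nonneg (mul_nonneg (sub_nonneg.2 hμ) (sub_nonneg.2 ht)) (sub_nonneg.2 hs)]

/-! ### The scalar recursion. -/

/-- The recursion `τ ↦ τ (1 - m (1 - τ))` that bounds the correlations between layers. -/
def corrBound (m r : ℝ) : ℕ → ℝ
  | 0 => r
  | k + 1 => corrBound m r k * (1 - m * (1 - corrBound m r k))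

section corrBound

variable {m r : ℝ}

theorem corrBound_mem (hm0 : 0 ≤ m) (hm1 : m ≤ 1) (hr0 : 0 ≤ r) (hr1 : r ≤ 1) (k : ℕ) :
    0 ≤ corrBound m r k ∧ corrBound m r k ≤ 1 := by
  induction k with
  | zero => exact ⟨hr0, hr1⟩
  | succ k ih =>
    obtain ⟨h0, h1⟩ := ih
    have h2 : m * (1 - corrBound m r k) ≤ 1 := mul_le_one₀ hm1 (by linarith) (by linarith)
    have h3 : 0 ≤ m * (1 - corrBound m r k) := mul_nonneg hm0 (by linarith)
    exact ⟨mul_nonneg h0 (by linarith), mul_le_one₀ h1 (by linarith) (by linarith)⟩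

theorem corrBound_factor_nonneg (hm0 : 0 ≤ m) (hm1 : m ≤ 1) (hr0 : 0 ≤ r) (hr1 : r ≤ 1) (k : ℕ) :
    0 ≤ 1 - m * (1 - corrBound m r k) := by
  obtain ⟨h0, h1⟩ := corrBound_mem hm0 hm1 hr0 hr1 k
  have : m * (1 - corrBound m r k) ≤ 1 := mul_le_one₀ hm1 (by linarith) (by linarith)
  linarith

theorem corrBound_succ_le (hm0 : 0 ≤ m) (hm1 : m ≤ 1) (hr0 : 0 ≤ r) (hr1 : r ≤ 1) (k : ℕ) :
    corrBound m r (k + 1) ≤ corrBound m r k := by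
  obtain ⟨h0, h1⟩ := corrBound_mem hm0 hm1 hr0 hr1 k
  have h3 : 0 ≤ m * (1 - corrBound m r k) := mul_nonneg hm0 (by linarith)
  exact mul_le_of_le_one_right h0 (by linarith)

/-- With factors indexed from `k` to `L - 1` this would be an equality; shifting the index by one
only decreases them, since `corrBound` is decreasing. -/
theorem corrBound_mul_prod_le (hm0 : 0 ≤ m) (hm1 : m ≤ 1) (hr0 : 0 ≤ r) (hr1 : r ≤ 1) {k L : ℕ}
    (hkL : k ≤ L) :
    corrBound m r k * ∏ i ∈ Finset.Icc (k + 1) L, (1 - m * (1 - corrBound m r i)) ≤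
      corrBound m r L := by
  induction L, hkL using Nat.le_induction with
  | base => simp
  | succ L hkL ih =>
    rw [Finset.prod_Icc_succ_top (by omega), ← mul_assoc]
    refine mul_le_mul ih ?_ (corrBound_factor_nonneg hm0 hm1 hr0 hr1 _)
      (corrBound_mem hm0 hm1 hr0 hr1 _).1
    have := mul_le_mul_of_nonneg_left (corrBound_succ_le hm0 hm1 hr0 hr1 L) hm0
    linarith

/-- The odds `τ / (1 - τ)` shrink at least by the factor `1 + m` in each step. -/
theorem corrBound_mul_pow_le (hm0 : 0 ≤ m) (hm1 : m ≤ 1) (hr0 : 0 ≤ r) (hr1 : r ≤ 1) (k : ℕ) :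
    corrBound m r k * (1 + m) ^ k * (1 - r) ≤ 1 - corrBound m r k := by
  induction k with
  | zero =>
    simp only [corrBound, pow_zero, mul_one]
    exact mul_le_of_le_one_left (by linarith) hr1
  | succ k ih =>
    obtain ⟨h0, h1⟩ := corrBound_mem hm0 hm1 hr0 hr1 k
    have hf := corrBound_factor_nonneg hm0 hm1 hr0 hr1 k
    rw [pow_succ, corrBound]
    set τ := corrBound m r k
    have e : τ * (1 - m * (1 - τ)) * ((1 + m) ^ k * (1 + m)) * (1 - r) =
        τ * (1 + m) ^ k * (1 - r) * ((1 - m * (1 - τ)) * (1 + m)) := by ring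
    rw [e]
    refine (mul_le_mul_of_nonneg_right ih (mul_nonneg hf (by linarith))).trans ?_
    have : 1 - τ * (1 - m * (1 - τ)) = (1 - τ) * (1 + m * τ) := by ring
    rw [this]
    refine mul_le_mul_of_nonneg_left ?_ (by linarith)
    -- `(1 - m (1 - τ)) (1 + m) = 1 + m τ - m² (1 - τ)`.
    nlinarith [mul_nonneg (sq_nonneg m) (sub_nonneg.2 h1)]

end corrBound

/-! ### From the recursion to the kernel. -/

theorem IsNormalizedActivation.abs_iterate_dualActivation_le (hσ : IsNormalizedActivation σ)
    (hμ : 0 ≤ nonlinearity σ) {ρ : ℝ} (hρ : |ρ| ≤ 1) (k : ℕ) :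
    |(dualActivation σ)^[k] ρ| ≤ corrBound (nonlinearity σ) |ρ| k := by
  have hμ1 := IsNormalizedActivation.nonlinearity_le_one (σ := σ)
  induction k with
  | zero => simp [corrBound]
  | succ k ih =>
    rw [Function.iterate_succ_apply']
    have h1 := (corrBound_mem hμ hμ1 (abs_nonneg ρ) hρ k).2
    have hf := corrBound_factor_nonneg hμ hμ1 (abs_nonneg ρ) hρ k
    refine (hσ.abs_dualActivation_le (ih.trans h1)).trans ?_
    rw [corrBound]
    have h2 := mul_le_mul_of_nonneg_left ih hμ
    refine (mul_le_mul_of_nonneg_left ?_ (abs_nonneg _)).trans (mul_le_mul_of_nonneg_right ih hf)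
    linarith

theorem IsNormalizedActivation.ntkFun_one (hσ : IsNormalizedActivation σ) (L : ℕ) :
    ntkFun σ L 1 =
      ∑ h ∈ Finset.Icc 1 (L + 1), ∏ _i ∈ Finset.Icc h L, dualActivation (deriv σ) 1 := by
  simp only [ntkFun, Function.iterate_fixed hσ.dualActivation_one, one_mul]

theorem IsNormalizedActivation.ntkFun_one_pos (hσ : IsNormalizedActivation σ) (L : ℕ) :
    0 < ntkFun σ L 1 := by
  rw [hσ.ntkFun_one]
  have hs := hσ.one_le_dualActivation_deriv_one
  exact Finset.sum_pos (fun h _ ↦ Finset.prod_pos fun i _ ↦ by linarith) ⟨1, by simp⟩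

/-- Termwise: the powers of `S` are those of the diagonal entry, and the contraction factors combine
with the bound on the iterate through `corrBound_mul_prod_le`. -/
theorem IsNormalizedActivation.abs_ntkFun_le (hσ : IsNormalizedActivation σ)
    (hμ : 0 ≤ nonlinearity σ) {ρ : ℝ} (hρ : |ρ| ≤ 1) (L : ℕ) :
    |ntkFun σ L ρ| ≤ corrBound (nonlinearity σ) |ρ| L * ntkFun σ L 1 := by
  have hμ1 := IsNormalizedActivation.nonlinearity_le_one (σ := σ)
  have hs := hσ.one_le_dualActivation_deriv_one
  rw [hσ.ntkFun_one, Finset.mul_sum, ntkFun]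
  refine (Finset.abs_sum_le_sum_abs _ _).trans (Finset.sum_le_sum fun h hh ↦ ?_)
  rw [Finset.mem_Icc] at hh
  obtain ⟨k, rfl⟩ : ∃ k, h = k + 1 := ⟨h - 1, by omega⟩
  rw [abs_mul, Finset.abs_prod, Nat.add_sub_cancel]
  set τ := corrBound (nonlinearity σ) |ρ| with hτ
  have hprod : ∏ i ∈ Finset.Icc (k + 1) L,
      |dualActivation (deriv σ) ((dualActivation σ)^[i] ρ)| ≤
      (∏ _i ∈ Finset.Icc (k + 1) L, dualActivation (deriv σ) 1) *
        ∏ i ∈ Finset.Icc (k + 1) L, (1 - nonlinearity σ * (1 - τ i)) := by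
    rw [← Finset.prod_mul_distrib]
    refine Finset.prod_le_prod (fun _ _ ↦ abs_nonneg _) fun i _ ↦ ?_
    have ih := hσ.abs_iterate_dualActivation_le hμ hρ i
    refine (hσ.abs_dualActivation_deriv_le
      (ih.trans (corrBound_mem hμ hμ1 (abs_nonneg ρ) hρ i).2)).trans ?_
    refine mul_le_mul_of_nonneg_left ?_ (by linarith)
    have := mul_le_mul_of_nonneg_left ih hμ
    rw [hτ]
    linarith
  have hS : 0 ≤ ∏ _i ∈ Finset.Icc (k + 1) L, dualActivation (deriv σ) 1 :=
    Finset.prod_nonneg fun _ _ ↦ by linarith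
  calc _ ≤ τ k * ((∏ _i ∈ Finset.Icc (k + 1) L, dualActivation (deriv σ) 1) *
        ∏ i ∈ Finset.Icc (k + 1) L, (1 - nonlinearity σ * (1 - τ i))) :=
        mul_le_mul (hσ.abs_iterate_dualActivation_le hμ hρ k) hprod
          (Finset.prod_nonneg fun _ _ ↦ abs_nonneg _)
          (corrBound_mem hμ hμ1 (abs_nonneg ρ) hρ k).1
    _ = τ k * (∏ i ∈ Finset.Icc (k + 1) L, (1 - nonlinearity σ * (1 - τ i))) *
        ∏ _i ∈ Finset.Icc (k + 1) L, dualActivation (deriv σ) 1 := by ring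
    _ ≤ _ := mul_le_mul_of_nonneg_right
        (corrBound_mul_prod_le hμ hμ1 (abs_nonneg ρ) hρ (by omega)) hS

/-- From `exp (-m / 2) ≥ 1 - m / 2` and `(1 + m) (1 - m / 2) ≥ 1`. This loss of `2`, times the
fourth power of `n / δ`, makes the `8` in `convDepth`. -/
theorem one_le_exp_half {m : ℝ} (hm0 : 0 ≤ m) (hm1 : m ≤ 1) : Real.exp (m / 2) ≤ 1 + m := by
  have h := Real.add_one_le_exp (-(m / 2))
  have h2 : Real.exp (m / 2) * Real.exp (-(m / 2)) = 1 := by rw [← Real.exp_add]; simp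
  have h3 := Real.exp_pos (m / 2)
  nlinarith

/-- At the convergence depth, `(1 + μ) ^ L` dominates `(n / δ) ^ 4`. -/
theorem pow_four_le_of_convDepth_le {n L : ℕ} {δ m : ℝ} (hn : 0 < n) (hδ : 0 < δ) (hm0 : 0 < m)
    (hm1 : m ≤ 1) (hL : convDepth n δ m ≤ L) : (n / δ) ^ 4 ≤ (1 + m) ^ L := by
  have hpos : (0 : ℝ) < n / δ := by positivity
  rw [convDepth, div_le_iff₀ hm0] at hL
  calc ((n : ℝ) / δ) ^ 4 = Real.exp (4 * Real.log (n / δ)) := by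
        rw [mul_comm, Real.exp_mul, Real.exp_log hpos]
        norm_cast
    _ ≤ Real.exp (L * (m / 2)) := Real.exp_le_exp.2 (by linarith)
    _ = Real.exp (m / 2) ^ L := Real.exp_nat_mul _ _
    _ ≤ (1 + m) ^ L := pow_le_pow_left₀ (Real.exp_pos _).le (one_le_exp_half hm0.le hm1) _

theorem abs_inner_le_one_of_norm_eq_one {d : ℕ} {u v : EuclideanSpace ℝ (Fin d)}
    (hu : ‖u‖ = 1) (hv : ‖v‖ = 1) : |(⟪u, v⟫ : ℝ)| ≤ 1 := by
  simpa [hu, hv] using abs_real_inner_le_norm u v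

theorem datasetSeparability_le {n d : ℕ} (x : Fin n → EuclideanSpace ℝ (Fin d)) {i j : Fin n}
    (hij : i ≠ j) : datasetSeparability x ≤ separability (x i) (x j) :=
  ciInf_le (Set.finite_range _).bddBelow
    (⟨(i, j), hij⟩ : {p : Fin n × Fin n // p.1 ≠ p.2})


end DeepNTK

/-! ### The main theorem. -/

theorem mainTheorem5 {n d : ℕ} [NeZero n] (L : ℕ) (σ : ℝ → ℝ)
    (hσ : DeepNTK.IsNormalizedActivation σ) (hμ : 0 < DeepNTK.nonlinearity σ)
    (x : Fin n → EuclideanSpace ℝ (Fin d)) (hx : ∀ i, ‖x i‖ = 1)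
    (δ : ℝ) (hδ : 0 < δ) (hδ' : δ ≤ DeepNTK.datasetSeparability x)
    (hL : DeepNTK.convDepth n δ (DeepNTK.nonlinearity σ) ≤ (L : ℝ)) :
    0 < DeepNTK.ntkMatrix σ L x 0 0 ∧
    ∀ i j : Fin n, i ≠ j →
      (DeepNTK.separability (x i) (x j) < 1 / 2 →
        |DeepNTK.ntkMatrix σ L x i j / DeepNTK.ntkMatrix σ L x 0 0| ≤
          (δ / (DeepNTK.separability (x i) (x j) * n)) ^ 2) ∧
      (1 / 2 ≤ DeepNTK.separability (x i) (x j) →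
        |DeepNTK.ntkMatrix σ L x i j / DeepNTK.ntkMatrix σ L x 0 0| ≤ (δ / n) ^ 2) ∧
      |DeepNTK.ntkMatrix σ L x i j / DeepNTK.ntkMatrix σ L x 0 0| ≤ 1 / (n : ℝ) ^ 2 := by
  have h00 : DeepNTK.ntkMatrix σ L x 0 0 = DeepNTK.ntkFun σ L 1 := by
    simp [DeepNTK.ntkMatrix, hx]
  have hpos := hσ.ntkFun_one_pos L
  rw [h00]
  refine ⟨hpos, fun i j hij ↦ ?_⟩
  have hn : 2 ≤ n := by
    have := i.isLt
    have := j.isLt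
    have := Fin.val_ne_of_ne hij
    omega
  have hn' : (2 : ℝ) ≤ n := by exact_mod_cast hn
  have hμ1 := DeepNTK.IsNormalizedActivation.nonlinearity_le_one (σ := σ)
  have hρ := DeepNTK.abs_inner_le_one_of_norm_eq_one (hx i) (hx j)
  set ρ : ℝ := ⟪x i, x j⟫ with hρdef
  have hs : DeepNTK.separability (x i) (x j) = 1 - |ρ| := rfl
  have hδs := hδ'.trans (DeepNTK.datasetSeparability_le x hij)
  rw [hs] at hδs ⊢
  have hB : |DeepNTK.ntkMatrix σ L x i j / DeepNTK.ntkFun σ L 1| ≤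
      DeepNTK.corrBound (DeepNTK.nonlinearity σ) |ρ| L := by
    rw [abs_div, abs_of_pos hpos, div_le_iff₀ hpos]
    exact hσ.abs_ntkFun_le hμ.le hρ L
  have hodds := DeepNTK.corrBound_mul_pow_le hμ.le hμ1 (abs_nonneg ρ) hρ L
  have hpow := DeepNTK.pow_four_le_of_convDepth_le (by omega) hδ hμ hμ1 hL
  have h0 := (DeepNTK.corrBound_mem hμ.le hμ1 (abs_nonneg ρ) hρ L).1
  set K := |DeepNTK.ntkMatrix σ L x i j / DeepNTK.ntkFun σ L 1|
  set τ := DeepNTK.corrBound (DeepNTK.nonlinearity σ) |ρ| L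
  set s := 1 - |ρ| with hsdef
  have hs1 : s ≤ 1 := by linarith [abs_nonneg ρ]
  have hs0 : 0 < s := hδ.trans_le hδs
  set q := δ / n with hq
  have hq0 : 0 < q := by positivity
  have hq2 : q ≤ 1 / 2 := by
    rw [hq, div_le_div_iff₀ (by linarith) (by norm_num)]
    linarith
  -- The odds bound gives `τ * s * (1 + μ)^L ≤ 1 - τ ≤ 1`, and `(1 + μ)^L ≥ q⁻⁴`.
  have hK : K ≤ q ^ 4 / s := by
    refine hB.trans ?_
    rw [le_div_iff₀ hs0]
    have h1 : τ * s * ((n : ℝ) / δ) ^ 4 ≤ 1 :=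
      calc _ ≤ τ * s * (1 + DeepNTK.nonlinearity σ) ^ L :=
            mul_le_mul_of_nonneg_left hpow (mul_nonneg h0 hs0.le)
        _ = τ * (1 + DeepNTK.nonlinearity σ) ^ L * s := by ring
        _ ≤ 1 := hodds.trans (by linarith)
    have h2 : q ^ 4 * ((n : ℝ) / δ) ^ 4 = 1 := by
      rw [← mul_pow, hq, div_mul_div_cancel₀ (by positivity), div_self hδ.ne', one_pow]
    rw [← h2] at h1
    exact le_of_mul_le_mul_right h1 (by positivity)
  -- Valid for every `s`, since `q ≤ 1` and `s ≤ 1`; with `δ ≤ s` it also yields the bound `1 / n²`.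
  have hsmall : K ≤ (δ / (s * n)) ^ 2 := by
    refine hK.trans ?_
    have e : (δ / (s * n)) ^ 2 = q ^ 2 / s ^ 2 := by
      rw [hq]
      field_simp
    rw [e]
    refine div_le_div₀ (by positivity) ?_ (by positivity) ?_
    · exact pow_le_pow_of_le_one hq0.le (by linarith) (by norm_num)
    · exact pow_le_of_le_one hs0.le hs1 (by norm_num)
  refine ⟨fun _ ↦ hsmall, fun hs2 ↦ hK.trans ?_, hsmall.trans ?_⟩
  · rw [div_le_iff₀ hs0]
    -- `q² ≤ 1/4 < 1/2 ≤ s`.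
    have : q ^ 2 ≤ s := by nlinarith
    calc q ^ 4 = q ^ 2 * q ^ 2 := by ring
      _ ≤ q ^ 2 * s := by gcongr
  · rw [← one_div_pow]
    refine pow_le_pow_left₀ (by positivity) ?_ 2
    rw [div_le_div_iff₀ (by positivity) (by positivity)]
    nlinarith
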